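/- Let $\mathcal O_2$ be the Cuntz algebra, that is, a nonzero unital $C^*$-algebra generated by two isometries $S_1, S_2$ with $S_1S_1^*+S_2S_2^*=1$. For a finite word $\mu=\mu_1\cdots\mu_k$ ($k\ge 0$) over $\{1,2\}$ put $S_\mu=S_{\mu_1}\cdots S_{\mu_k}$ (with $S_\emptyset=1$) and $P_\mu=S_\mu S_\mu^*$. Let $\mathcal D_2$ be the $C^*$-subalgebra of $\mathcal O_2$ generated by all the projections $P_\mu$ (the diagonal), and let $V$ (a copy of Thompson's group $V$) be the set of all unitaries $w\in\mathcal O_2$ of the form $w=\sum_{(\mu,\nu)\in\mathcal J}S_\mu S_\nu^*$, where $\mathcal J$ is a finite set of pairs of finite words over $\{1,2\}$. Let $\alpha$ be a unital $*$-endomorphism of $\mathcal O_2$. If $\alpha(V)\subseteq V$, then $\alpha(\mathcal D_2)\subseteq\mathcal D_2$. -/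

import Mathlib

/-- For `n ≥ 2`: `S₁, …, Sₙ` present `A` as the Cuntz algebra `𝒪ₙ`: `A` is a nonzero unital C⋆-algebra generated,
as a C⋆-algebra, by the isometries `S₁, …, Sₙ`, and `∑ᵢ Sᵢ Sᵢ⋆ = 1`. -/
structure IsCuntzAlgebra {A : Type*} [CStarAlgebra A] {n : ℕ} (S : Fin n → A) : Prop where
  one_ne_zero : (1 : A) ≠ 0
  isometry : ∀ i, star (S i) * S i = 1
  sum_range_proj : ∑ i, S i * star (S i) = 1
  generates : (StarAlgebra.adjoin ℂ (Set.range S)).topologicalClosure = ⊤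

namespace Cuntz

/-- `S_μ = S_{μ₁} ⋯ S_{μₖ}` for a multi-index `μ = μ₁ … μₖ`, with `S_∅ = 1`. -/
def word {A : Type*} [CStarAlgebra A] {n : ℕ} (S : Fin n → A) (μ : List (Fin n)) : A :=
  (μ.map S).prod

/-- The range projection `P_μ = S_μ S_μ⋆`. -/
def proj {A : Type*} [CStarAlgebra A] {n : ℕ} (S : Fin n → A) (μ : List (Fin n)) : A :=
  word S μ * star (word S μ)

/-- The diagonal `𝒟ₙ`: the C⋆-subalgebra of `𝒪ₙ` generated by all the projections `P_μ`. -/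
def diagonal {A : Type*} [CStarAlgebra A] {n : ℕ} (S : Fin n → A) : StarSubalgebra ℂ A :=
  (StarAlgebra.adjoin ℂ (Set.range (proj S))).topologicalClosure

/-- The set `𝒱ₙ` of all elements `∑_{(α, β) ∈ J} S_α S_β⋆`, where `J` is a finite set of pairs of
multi-indices. -/
def sums {A : Type*} [CStarAlgebra A] {n : ℕ} (S : Fin n → A) : Set A :=
  {w | ∃ J : Finset (List (Fin n) × List (Fin n)), w = ∑ p ∈ J, word S p.1 * star (word S p.2)}

/-- The unitaries in `𝒱ₙ`; for `n = 2` this is the Thompson group `V` inside `𝒰(𝒪₂)`. -/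
def thompsonV {A : Type*} [CStarAlgebra A] {n : ℕ} (S : Fin n → A) : Set A :=
  sums S ∩ (unitary A : Set A)

end Cuntz

/-! Write `z n` for the isometry S₀ⁿS₁. Compressing a monomial S_μ S_ν⋆ by `z n` gives, for large n,
the scalar 1 if μ and ν are the same power of the letter 0, and the scalar 0 otherwise. By density
the compressions of every a converge to a scalar ω(a), and ω is a state (`exists_hasValue`,
`HasValue.nonneg`). In its GNS representation, with cyclic vector ξ, any two vectors S_μ S_ν⋆ ξ have
inner product 0 or 1. So the unit vectors among them form an orthonormal set O, and V permutes O
(`map_thompsonV_mem_points`).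

Let p = α(P_μ). Elements of V split P_μ into two halves, exchange the halves, exchange one half with
either half of the other, and act trivially off P_μ. Their images under α are again in V, so they
permute O. On a finite orbit in O the halves of p have trace t with t = 2t, so p vanishes there. On
an infinite orbit the vectors fixed by the group, among them (1 - p)z, are orthogonal to the orbit,
so p is the identity there. Hence p is diagonal on O (`apply_eq_zero_or_self`), which forces ω(S_σ⋆
p S_τ) = 0 for σ ≠ τ.

Finally, these coefficients determine an element. With Φ the canonical endomorphism and Y = ∑_{k<N}
Φᵏ(z n), n ≥ N, one has Y⋆Y = N, while the commutators of Y with the S_i⋆ are bounded independently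
of N; so N⁻¹Y⋆aY is close to a for suitable N. As n → ∞ it tends to N⁻¹ ∑ ω(S_σ⋆ a S_τ) S_σ S_τ⋆
over words shorter than N, which is in the diagonal when the off-diagonal coefficients vanish
(`mem_diagonal_of_hasValue_zero`). -/

open Filter Topology

namespace Cuntz

variable {A : Type*} [CStarAlgebra A]

/-! ### Monomials and the canonical endomorphism. -/

section Words

variable {n : ℕ} (S : Fin n → A)

@[simp] lemma word_nil : word S [] = 1 := by simp [word]

@[simp] lemma word_cons (i : Fin n) (μ : List (Fin n)) : word S (i :: μ) = S i * word S μ := by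
  simp [word]

@[simp] lemma word_append (μ ν : List (Fin n)) : word S (μ ++ ν) = word S μ * word S ν := by
  simp [word]

lemma proj_append (μ ν : List (Fin n)) :
    proj S (μ ++ ν) = word S μ * proj S ν * star (word S μ) := by
  simp [proj, mul_assoc]

variable {S}

/-- Compressing ∑ S_k S_k⋆ = 1 by S_j writes 1 as a sum of positive terms whose j-th term is already
1, so the others vanish. -/
lemma star_mul_of_ne (hS : IsCuntzAlgebra S) {i j : Fin n} (hij : i ≠ j) :
    star (S i) * S j = 0 := by
  let _ := CStarAlgebra.spectralOrder A
  let _ := CStarAlgebra.spectralOrderedRing A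
  have h1 : ∑ k, star (star (S k) * S j) * (star (S k) * S j) = 1 := by
    have : ∑ k, star (star (S k) * S j) * (star (S k) * S j)
        = star (S j) * (∑ k, S k * star (S k)) * S j := by
      simp [Finset.mul_sum, Finset.sum_mul, mul_assoc]
    rw [this, hS.sum_range_proj, mul_one, hS.isometry]
  rw [← Finset.add_sum_erase _ _ (Finset.mem_univ j)] at h1
  simp only [hS.isometry, star_one, mul_one, add_eq_left] at h1
  have h2 := (Finset.sum_eq_zero_iff_of_nonneg (fun k _ => star_mul_self_nonneg _)).1 h1 i
    (by simp [hij])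
  exact CStarRing.star_mul_self_eq_zero_iff _ |>.1 h2

@[simp] lemma star_word_mul_word_self (hS : IsCuntzAlgebra S) (μ : List (Fin n)) :
    star (word S μ) * word S μ = 1 := by
  induction μ with
  | nil => simp
  | cons i μ ih =>
    rw [word_cons, star_mul, mul_assoc, ← mul_assoc _ (S i), hS.isometry, one_mul, ih]

lemma star_word_append_mul_word_append (hS : IsCuntzAlgebra S) (μ κ ν : List (Fin n)) :
    star (word S (μ ++ κ)) * word S (μ ++ ν) = star (word S κ) * word S ν := by
  rw [word_append, word_append, star_mul, mul_assoc, ← mul_assoc _ (word S μ),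
    star_word_mul_word_self hS, one_mul]

lemma star_word_mul_word (hS : IsCuntzAlgebra S) (μ ν : List (Fin n)) :
    (∃ κ, ν = μ ++ κ) ∨ (∃ κ, μ = ν ++ κ) ∨ star (word S μ) * word S ν = 0 := by
  induction μ generalizing ν with
  | nil => simp
  | cons i μ ih =>
    cases ν with
    | nil => simp
    | cons j ν =>
      by_cases h : i = j
      · subst h
        obtain ⟨κ, rfl⟩ | ⟨κ, rfl⟩ | h := ih ν
        · simp
        · simp
        · right; right
          rw [word_cons, word_cons, star_mul, mul_assoc, ← mul_assoc _ (S i), hS.isometry,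
            one_mul, h]
      · right; right
        rw [word_cons, word_cons, star_mul, mul_assoc, ← mul_assoc _ (S j), star_mul_of_ne hS h]
        simp

/-- The elements `S_μ S_ν⋆`, together with `0`. -/
def monomials (S : Fin n → A) : Set A :=
  {m | m = 0 ∨ ∃ μ ν, m = word S μ * star (word S ν)}

lemma star_mem_monomials {m : A} (hm : m ∈ monomials S) : star m ∈ monomials S := by
  obtain rfl | ⟨μ, ν, rfl⟩ := hm
  · exact Or.inl (star_zero _)
  · exact Or.inr ⟨ν, μ, by simp⟩

lemma word_mul_star_word_mem (μ ν : List (Fin n)) :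
    word S μ * star (word S ν) ∈ monomials S := Or.inr ⟨μ, ν, rfl⟩

lemma word_mem_monomials (μ : List (Fin n)) : word S μ ∈ monomials S := Or.inr ⟨μ, [], by simp⟩

lemma mul_mem_monomials (hS : IsCuntzAlgebra S) {m m' : A} (hm : m ∈ monomials S)
    (hm' : m' ∈ monomials S) : m * m' ∈ monomials S := by
  obtain rfl | ⟨μ, ν, rfl⟩ := hm
  · exact Or.inl (zero_mul _)
  obtain rfl | ⟨σ, τ, rfl⟩ := hm'
  · exact Or.inl (mul_zero _)
  have h : word S μ * star (word S ν) * (word S σ * star (word S τ))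
      = word S μ * (star (word S ν) * word S σ) * star (word S τ) := by simp only [mul_assoc]
  rw [h]
  obtain ⟨κ, rfl⟩ | ⟨κ, rfl⟩ | h0 := star_word_mul_word hS ν σ
  · refine Or.inr ⟨μ ++ κ, τ, ?_⟩
    rw [word_append, ← mul_assoc (star _), star_word_mul_word_self hS, one_mul, word_append]
  · refine Or.inr ⟨μ, τ ++ κ, ?_⟩
    rw [word_append, star_mul, mul_assoc (star _), star_word_mul_word_self hS, mul_one,
      word_append, star_mul, mul_assoc]
  · exact Or.inl (by rw [h0]; simp)

lemma adjoin_le_span_monomials (hS : IsCuntzAlgebra S) {a : A}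
    (ha : a ∈ StarAlgebra.adjoin ℂ (Set.range S)) : a ∈ Submodule.span ℂ (monomials S) := by
  induction ha using StarAlgebra.adjoin_induction with
  | mem x hx =>
    obtain ⟨i, rfl⟩ := hx
    exact Submodule.subset_span (Or.inr ⟨[i], [], by simp⟩)
  | algebraMap r =>
    rw [Algebra.algebraMap_eq_smul_one]
    exact Submodule.smul_mem _ _ (Submodule.subset_span (Or.inr ⟨[], [], by simp⟩))
  | add x y _ _ hx hy => exact add_mem hx hy
  | mul x y _ _ hx hy =>
    have := Submodule.mul_mem_mul hx hy
    rw [Submodule.span_mul_span] at this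
    refine Submodule.span_mono ?_ this
    rintro _ ⟨m, hm, m', hm', rfl⟩
    exact mul_mem_monomials hS hm hm'
  | star x h hx =>
    clear h
    induction hx using Submodule.span_induction with
    | mem x hx => exact Submodule.subset_span (star_mem_monomials hx)
    | zero => simp
    | add x y _ _ hx hy => rw [star_add]; exact add_mem hx hy
    | smul c x _ hx => rw [star_smul]; exact Submodule.smul_mem _ _ hx

/-- The monomials span a dense subspace. -/
lemma mem_closure_span_monomials (hS : IsCuntzAlgebra S) (a : A) :
    a ∈ closure (Submodule.span ℂ (monomials S) : Set A) := by
  have h : a ∈ (StarAlgebra.adjoin ℂ (Set.range S)).topologicalClosure := by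
    rw [hS.generates]; trivial
  exact closure_mono (fun x hx => adjoin_le_span_monomials hS hx) h

/-- The words of length `k`. -/
def levelWords (n : ℕ) : ℕ → Finset (List (Fin n))
  | 0 => {[]}
  | k + 1 => (Finset.univ ×ˢ levelWords n k).image fun p => p.1 :: p.2

lemma mem_levelWords {k : ℕ} {μ : List (Fin n)} : μ ∈ levelWords n k ↔ μ.length = k := by
  induction k generalizing μ with
  | zero => simp [levelWords]
  | succ k ih =>
    cases μ with
    | nil => simp [levelWords]
    | cons i μ => simp [levelWords, ih]

lemma sum_levelWords_succ {M : Type*} [AddCommMonoid M] (k : ℕ) (f : List (Fin n) → M) :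
    ∑ μ ∈ levelWords n (k + 1), f μ = ∑ i, ∑ μ ∈ levelWords n k, f (i :: μ) := by
  rw [levelWords, Finset.sum_image (by rintro ⟨i, μ⟩ _ ⟨j, ν⟩ _ h; simpa using h),
    Finset.sum_product]

/-- The canonical endomorphism `a ↦ ∑ᵢ Sᵢ a Sᵢ⋆` of the Cuntz algebra, as a map. -/
def shift (S : Fin n → A) (a : A) : A := ∑ i, S i * a * star (S i)

lemma shift_iterate (k : ℕ) (a : A) :
    (shift S)^[k] a = ∑ μ ∈ levelWords n k, word S μ * a * star (word S μ) := by
  induction k with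
  | zero => simp [levelWords]
  | succ k ih =>
    rw [Function.iterate_succ_apply', ih, sum_levelWords_succ]
    simp [shift, Finset.mul_sum, Finset.sum_mul, mul_assoc]

lemma shift_one (hS : IsCuntzAlgebra S) : shift S (1 : A) = 1 := by
  simpa [shift] using hS.sum_range_proj

lemma sum_levelWords_proj (hS : IsCuntzAlgebra S) (k : ℕ) :
    ∑ μ ∈ levelWords n k, proj S μ = 1 := by
  have := shift_iterate (S := S) k 1
  rw [Function.iterate_fixed (shift_one hS)] at this
  simpa [proj] using this.symm

/-- This intertwining makes the commutators with averages telescope later on. -/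
lemma star_mul_shift (hS : IsCuntzAlgebra S) (i : Fin n) (a : A) :
    star (S i) * shift S a = a * star (S i) := by
  rw [shift, Finset.mul_sum, Finset.sum_eq_single i]
  · rw [mul_assoc, ← mul_assoc, hS.isometry, one_mul]
  · intro j _ hj
    rw [mul_assoc, ← mul_assoc, star_mul_of_ne hS hj.symm, zero_mul]
  · simp

lemma shift_star (a : A) : shift S (star a) = star (shift S a) := by
  simp [shift, mul_assoc]

lemma shift_mul (hS : IsCuntzAlgebra S) (a b : A) : shift S (a * b) = shift S a * shift S b := by
  conv_rhs => rw [shift, Finset.sum_mul]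
  simp_rw [mul_assoc, star_mul_shift hS, shift, mul_assoc]

@[simp] lemma shift_zero : shift S (0 : A) = 0 := by simp [shift]

lemma shift_iterate_star_mul (hS : IsCuntzAlgebra S) (k : ℕ) (a b : A) :
    (shift S)^[k] (star a * b) = star ((shift S)^[k] a) * (shift S)^[k] b := by
  induction k generalizing a b with
  | zero => rfl
  | succ k ih => simp only [Function.iterate_succ_apply, shift_mul hS, shift_star, ih]

lemma norm_le_one_of_star_mul_self {v : A} (hv : star v * v = 1) : ‖v‖ ≤ 1 := by
  rcases subsingleton_or_nontrivial A with h | h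
  · simp [Subsingleton.elim v 0]
  · have : ‖v‖ * ‖v‖ = 1 := by rw [← CStarRing.norm_star_mul_self, hv, norm_one]
    nlinarith [norm_nonneg v]

end Words

end Cuntz

namespace Cuntz

variable {A : Type*} [CStarAlgebra A]

/-! ### The state obtained as a limit of compressions. -/

section State

variable {S : Fin 2 → A}

/-- The isometries `S₀ⁿ S₁`. -/
def probe (S : Fin 2 → A) (n : ℕ) : A := S 0 ^ n * S 1

lemma probe_succ (n : ℕ) : probe S (n + 1) = S 0 * probe S n := by
  simp [probe, pow_succ', mul_assoc]

lemma star_probe_mul_probe (hS : IsCuntzAlgebra S) (i j : ℕ) :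
    star (probe S i) * probe S j = if i = j then 1 else 0 := by
  induction i generalizing j with
  | zero =>
    cases j with
    | zero => simp [probe, hS.isometry]
    | succ j =>
      rw [probe_succ, ← mul_assoc]
      simp [probe, star_mul_of_ne hS]
  | succ i ih =>
    rw [probe_succ, star_mul, mul_assoc]
    cases j with
    | zero => simp [probe, star_mul_of_ne hS]
    | succ j => rw [probe_succ, ← mul_assoc (star (S 0)), hS.isometry, one_mul, ih]; simp

lemma norm_probe_le (hS : IsCuntzAlgebra S) (n : ℕ) : ‖probe S n‖ ≤ 1 :=
  norm_le_one_of_star_mul_self (by simp [star_probe_mul_probe hS])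

/-- The first case occurs when all letters of ν are 0, each cancelling one S₀; any other letter
meets an S₀ and kills the product. The shift by the length of ν guarantees enough factors S₀. -/
lemma star_word_mul_probe (hS : IsCuntzAlgebra S) (ν : List (Fin 2)) :
    (∀ n, star (word S ν) * probe S (n + ν.length) = probe S n) ∨
      ∀ n, star (word S ν) * probe S (n + ν.length) = 0 := by
  induction ν with
  | nil => simp
  | cons i ν ih =>
    have key : ∀ n, star (word S (i :: ν)) * probe S (n + (i :: ν).length)
        = star (word S ν) * (star (S i) * S 0) * probe S (n + ν.length) := fun n => by
      rw [List.length_cons, ← add_assoc, probe_succ, word_cons, star_mul]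
      simp only [mul_assoc]
    by_cases h : i = 0
    · subst h
      simpa only [key, hS.isometry, mul_one] using ih
    · right
      intro n
      rw [key, star_mul_of_ne hS h]
      simp

lemma compress_word_mul_star_word (hS : IsCuntzAlgebra S) (μ ν : List (Fin 2)) :
    ∃ c : ℂ, (c = 0 ∨ c = 1) ∧ (μ.length ≠ ν.length → c = 0) ∧
      ∀ n, max μ.length ν.length ≤ n →
        star (probe S n) * (word S μ * star (word S ν)) * probe S n = algebraMap ℂ A c := by
  have key : ∀ n, star (probe S n) * (word S μ * star (word S ν)) * probe S n
      = star (star (word S μ) * probe S n) * (star (word S ν) * probe S n) := fun n => by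
    simp [mul_assoc]
  obtain h1 | h1 := star_word_mul_probe hS μ
  · obtain h2 | h2 := star_word_mul_probe hS ν
    · refine ⟨if μ.length = ν.length then 1 else 0, by split_ifs <;> simp, by simp_all,
        fun n hn => ?_⟩
      have e1 := h1 (n - μ.length)
      have e2 := h2 (n - ν.length)
      rw [Nat.sub_add_cancel (by omega)] at e1 e2
      rw [key, e1, e2, star_probe_mul_probe hS]
      by_cases h : μ.length = ν.length
      · simp [h]
      · rw [if_neg (by omega), if_neg h]; simp
    · refine ⟨0, by simp, by simp, fun n hn => ?_⟩
      have e2 := h2 (n - ν.length)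
      rw [Nat.sub_add_cancel (by omega)] at e2
      rw [key, e2]; simp
  · refine ⟨0, by simp, by simp, fun n hn => ?_⟩
    have e1 := h1 (n - μ.length)
    rw [Nat.sub_add_cancel (by omega)] at e1
    rw [key, e1]; simp

/-- `c` is the value at `a` of the limit of the compressions by the probes. -/
def HasValue (S : Fin 2 → A) (a : A) (c : ℂ) : Prop :=
  Tendsto (fun n => star (probe S n) * a * probe S n) atTop (𝓝 (algebraMap ℂ A c))

lemma norm_compress_le (hS : IsCuntzAlgebra S) (a : A) (n : ℕ) :
    ‖star (probe S n) * a * probe S n‖ ≤ ‖a‖ := by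
  have h := norm_probe_le hS n
  calc _ ≤ ‖star (probe S n)‖ * ‖a‖ * ‖probe S n‖ := norm_mul₃_le
    _ ≤ 1 * ‖a‖ * 1 := by rw [norm_star]; gcongr
    _ = ‖a‖ := by ring

lemma HasValue.add {a b : A} {c d : ℂ} (ha : HasValue S a c) (hb : HasValue S b d) :
    HasValue S (a + b) (c + d) := by
  have := Tendsto.add ha hb
  simpa only [HasValue, map_add, mul_add, add_mul] using this

lemma HasValue.smul {a : A} {c : ℂ} (k : ℂ) (ha : HasValue S a c) :
    HasValue S (k • a) (k * c) := by
  have := Tendsto.const_smul ha k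
  simpa only [HasValue, map_mul, mul_smul_comm, smul_mul_assoc, ← Algebra.smul_def] using this

lemma exists_hasValue_monomial (hS : IsCuntzAlgebra S) {m : A} (hm : m ∈ monomials S) :
    ∃ c : ℂ, (c = 0 ∨ c = 1) ∧ HasValue S m c := by
  obtain rfl | ⟨μ, ν, rfl⟩ := hm
  · exact ⟨0, by simp, by simp [HasValue]⟩
  · obtain ⟨c, hc, -, h⟩ := compress_word_mul_star_word hS μ ν
    refine ⟨c, hc, tendsto_const_nhds.congr' ?_⟩
    filter_upwards [eventually_ge_atTop (max μ.length ν.length)] with n hn using (h n hn).symm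

/-- The product is 0, or S_κ or S_κ⋆ with κ nonempty; a monomial with two words of different lengths
has value 0. -/
lemma hasValue_star_word_mul_word_of_ne (hS : IsCuntzAlgebra S) {μ ν : List (Fin 2)}
    (hμν : μ ≠ ν) : HasValue S (star (word S μ) * word S ν) 0 := by
  have key : ∀ σ τ : List (Fin 2), σ.length ≠ τ.length →
      HasValue S (word S σ * star (word S τ)) 0 := fun σ τ h => by
    obtain ⟨c, -, hc, h'⟩ := compress_word_mul_star_word hS σ τ
    obtain rfl := hc h
    refine tendsto_const_nhds.congr' ?_
    filter_upwards [eventually_ge_atTop (max σ.length τ.length)] with n hn using (h' n hn).symm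
  obtain ⟨κ, rfl⟩ | ⟨κ, rfl⟩ | h := star_word_mul_word hS μ ν
  · have := key κ [] (by simpa using hμν)
    rw [word_append, ← mul_assoc, star_word_mul_word_self hS]
    simpa using this
  · have := key [] κ (by simpa [eq_comm (a := 0)] using hμν)
    rw [word_append, star_mul, mul_assoc, star_word_mul_word_self hS]
    simpa using this
  · simp [h, HasValue]

lemma exists_hasValue (hS : IsCuntzAlgebra S) (a : A) : ∃ c, HasValue S a c := by
  have hspan : ∀ p ∈ Submodule.span ℂ (monomials S), ∃ c, HasValue S p c := fun p hp => by
    induction hp using Submodule.span_induction with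
    | mem x hx => exact (exists_hasValue_monomial hS hx).imp fun _ h => h.2
    | zero => exact ⟨0, by simp [HasValue]⟩
    | add x y _ _ hx hy => exact ⟨_, hx.choose_spec.add hy.choose_spec⟩
    | smul k x _ hx => exact ⟨_, hx.choose_spec.smul k⟩
  have : Nontrivial A := ⟨1, 0, hS.one_ne_zero⟩
  have hcauchy : CauchySeq fun n => star (probe S n) * a * probe S n := by
    rw [Metric.cauchySeq_iff']
    intro ε hε
    obtain ⟨p, hp, hap⟩ := Metric.mem_closure_iff.1 (mem_closure_span_monomials hS a) (ε / 3)
      (by positivity)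
    obtain ⟨c, hc⟩ := hspan p hp
    obtain ⟨N, hN⟩ := Metric.cauchySeq_iff'.1 hc.cauchySeq (ε / 3) (by positivity)
    refine ⟨N, fun n hn => ?_⟩
    have hd : ∀ k, dist (star (probe S k) * a * probe S k) (star (probe S k) * p * probe S k)
        < ε / 3 := fun k => by
      rw [dist_eq_norm, ← sub_mul, ← mul_sub]
      rw [dist_eq_norm] at hap
      exact (norm_compress_le hS _ k).trans_lt hap
    have h4 := dist_triangle4_right (star (probe S n) * a * probe S n)
      (star (probe S N) * a * probe S N) (star (probe S n) * p * probe S n)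
      (star (probe S N) * p * probe S N)
    linarith [hd n, hd N, hN n hn]
  obtain ⟨b, hb⟩ := cauchySeq_tendsto_of_complete hcauchy
  -- The limit is a scalar because the scalars are closed and, compressions being contractive, it is
  -- approximated by the values of elements of the span.
  have hclosed : IsClosed (Set.range (algebraMap ℂ A)) :=
    (algebraMap_isometry ℂ A).isClosedEmbedding.isClosed_range
  have hmem : b ∈ Set.range (algebraMap ℂ A) := by
    rw [← hclosed.closure_eq, Metric.mem_closure_iff]
    intro ε hε
    obtain ⟨p, hp, hap⟩ := Metric.mem_closure_iff.1 (mem_closure_span_monomials hS a) (ε / 2)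
      (by positivity)
    obtain ⟨c, hc⟩ := hspan p hp
    refine ⟨_, ⟨c, rfl⟩, ?_⟩
    rw [dist_eq_norm] at hap ⊢
    have := (Tendsto.sub hb hc).norm
    refine (le_of_tendsto this (Eventually.of_forall fun n => ?_)).trans_lt (hap.trans (by linarith))
    rw [← sub_mul, ← mul_sub]
    exact norm_compress_le hS _ n
  obtain ⟨c, rfl⟩ := hmem
  exact ⟨c, hb⟩

lemma HasValue.unique (hS : IsCuntzAlgebra S) {a : A} {c d : ℂ} (hc : HasValue S a c)
    (hd : HasValue S a d) : c = d := by
  have : Nontrivial A := ⟨1, 0, hS.one_ne_zero⟩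
  exact (algebraMap ℂ A).injective (tendsto_nhds_unique hc hd)

open scoped ComplexOrder in
lemma HasValue.nonneg [PartialOrder A] [StarOrderedRing A] (hS : IsCuntzAlgebra S) {a : A} {c : ℂ}
    (hc : HasValue S a c) (ha : 0 ≤ a) : 0 ≤ c := by
  have : Nontrivial A := ⟨1, 0, hS.one_ne_zero⟩
  have h : 0 ≤ algebraMap ℂ A c := ge_of_tendsto' hc fun n => star_left_conjugate_nonneg ha _
  have hstar : star c = c := (algebraMap ℂ A).injective <| by
    rw [algebraMap_star_comm, h.isSelfAdjoint.star_eq]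
  obtain ⟨r, rfl⟩ := Complex.conj_eq_iff_real.1 hstar
  have h' : 0 ≤ algebraMap ℝ A r := by simpa [Algebra.algebraMap_eq_smul_one] using h
  have := spectrum_nonneg_of_nonneg h' (x := r) (by simp)
  exact_mod_cast this

end State

end Cuntz

namespace Cuntz

/-! ### Involutions permuting an orthonormal set: finite versus infinite orbits. -/

section Dichotomy

variable {H : Type*} [NormedAddCommGroup H] [InnerProductSpace ℂ H]

/-- The points reached from `z` by repeatedly applying the operators `t i`. -/
def orbit {ι : Type*} (t : ι → H →L[ℂ] H) (z : H) : Set H :=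
  {y | Relation.ReflTransGen (fun a b => ∃ i, b = t i a) z y}

lemma self_mem_orbit {ι : Type*} (t : ι → H →L[ℂ] H) (z : H) : z ∈ orbit t z :=
  Relation.ReflTransGen.refl

lemma apply_mem_orbit {ι : Type*} {t : ι → H →L[ℂ] H} {z y : H} (hy : y ∈ orbit t z) (i : ι) :
    t i y ∈ orbit t z :=
  Relation.ReflTransGen.tail hy ⟨i, rfl⟩

lemma orbit_subset {ι : Type*} {t : ι → H →L[ℂ] H} {O : Set H}
    (hO : ∀ i, ∀ y ∈ O, t i y ∈ O) {z : H} (hz : z ∈ O) : orbit t z ⊆ O := by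
  intro y hy
  induction hy with
  | refl => exact hz
  | tail _ h ih => obtain ⟨i, rfl⟩ := h; exact hO i _ ih

lemma orthonormal_subtype {O : Set H} (h1 : ∀ y ∈ O, ‖y‖ = 1)
    (h2 : ∀ y ∈ O, ∀ y' ∈ O, y ≠ y' → inner ℂ y y' = 0) :
    Orthonormal ℂ (Subtype.val : O → H) :=
  ⟨fun y => h1 _ y.2, fun y y' hyy' => h2 _ y.2 _ y'.2 fun h => hyy' (Subtype.ext h)⟩

lemma norm_eq_one_of_inner_self {x : H} (h : inner ℂ x x = 1) : ‖x‖ = 1 := by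
  rw [inner_self_eq_norm_sq_to_K] at h
  have h2 : ((‖x‖ ^ 2 : ℝ) : ℂ) = 1 := by simpa using h
  exact (pow_eq_one_iff_of_nonneg (norm_nonneg x) two_ne_zero).1 (by exact_mod_cast h2)

variable [CompleteSpace H]

lemma inner_apply_eq_of_isSelfAdjoint {t : H →L[ℂ] H} (ht : IsSelfAdjoint t) (x y : H) :
    inner ℂ (t x) y = inner ℂ x (t y) := by
  rw [← ContinuousLinearMap.adjoint_inner_right, ← ContinuousLinearMap.star_eq_adjoint, ht.star_eq]

/-- A fixed vector has the same coefficient at every point of the orbit; by Bessel these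
coefficients are square summable, hence zero. -/
lemma inner_eq_zero_of_infinite_orbit {ι : Type*} {t : ι → H →L[ℂ] H}
    (hsa : ∀ i, IsSelfAdjoint (t i)) {O : Set H} (h1 : ∀ y ∈ O, ‖y‖ = 1)
    (h2 : ∀ y ∈ O, ∀ y' ∈ O, y ≠ y' → inner ℂ y y' = 0) (hO : ∀ i, ∀ y ∈ O, t i y ∈ O)
    {z : H} (hz : z ∈ O) (hinf : (orbit t z).Infinite) {u : H} (hu : ∀ i, t i u = u) :
    inner ℂ z u = 0 := by
  have hsub := orbit_subset hO hz
  have hconst : ∀ y ∈ orbit t z, inner ℂ y u = inner ℂ z u := fun y hy => by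
    induction hy with
    | refl => rfl
    | tail _ h ih =>
      obtain ⟨i, rfl⟩ := h
      rw [inner_apply_eq_of_isSelfAdjoint (hsa i), hu, ih]
  have hon : Orthonormal ℂ (Subtype.val : orbit t z → H) :=
    orthonormal_subtype (fun y hy => h1 y (hsub hy))
      fun y hy y' hy' => h2 y (hsub hy) y' (hsub hy')
  have hs := hon.inner_products_summable u
  have : Infinite (orbit t z) := hinf.to_subtype
  simp only [fun y : orbit t z => hconst y y.2] at hs
  simpa using (summable_const_iff _).1 hs

/-- Conjugation invariance of the trace over a finite orbit, which `t i` permutes. -/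
lemma sum_orbit_inner_conj {ι : Type*} {t : ι → H →L[ℂ] H} (hsa : ∀ i, IsSelfAdjoint (t i))
    (hinv : ∀ i, t i * t i = 1) {z : H} (hfin : (orbit t z).Finite) (i : ι) (p : H →L[ℂ] H) :
    ∑ y ∈ hfin.toFinset, inner ℂ y ((t i * p * t i) y)
      = ∑ y ∈ hfin.toFinset, inner ℂ y (p y) := by
  have hmap : ∀ y ∈ hfin.toFinset, t i y ∈ hfin.toFinset := fun y hy => by
    simp only [Set.Finite.mem_toFinset] at hy ⊢
    exact apply_mem_orbit hy i
  have hii : ∀ y, t i (t i y) = y := fun y => by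
    simpa using congrArg (fun s : H →L[ℂ] H => s y) (hinv i)
  refine Finset.sum_nbij' (t i) (t i) hmap hmap (fun y _ => hii y) (fun y _ => hii y)
    fun y _ => ?_
  simp [← inner_apply_eq_of_isSelfAdjoint (hsa i)]

/-- A projection `p` split into halves, one of which is split again, all pieces being exchanged by
involutions that permute an orthonormal set `O` and are trivial on `1 - p`, is diagonal on `O`. -/
lemma apply_eq_zero_or_self {O : Set H} (h1 : ∀ y ∈ O, ‖y‖ = 1)
    (h2 : ∀ y ∈ O, ∀ y' ∈ O, y ≠ y' → inner ℂ y y' = 0) {t : Fin 3 → H →L[ℂ] H}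
    (hsa : ∀ i, IsSelfAdjoint (t i)) (hinv : ∀ i, t i * t i = 1)
    (hO : ∀ i, ∀ y ∈ O, t i y ∈ O) {p q : H →L[ℂ] H} {r : Fin 3 → H →L[ℂ] H}
    (hpsa : IsSelfAdjoint p) (hpp : p * p = p) (hp : p = q + r 0) (hr : r 0 = r 1 + r 2)
    (hconj : ∀ i, t i * q * t i = r i) (hfix : ∀ i, t i * (1 - p) = 1 - p)
    {z : H} (hz : z ∈ O) : p z = 0 ∨ p z = z := by
  by_cases hfin : (orbit t z).Finite
  · left
    -- All `r i` have the same trace as `q`, and `r 0 = r 1 + r 2` turns this into t = 2t.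
    have hM := fun i => sum_orbit_inner_conj hsa hinv hfin i q
    simp only [hconj] at hM
    have h0 := hM 0
    simp only [hr, add_apply, inner_add_right, Finset.sum_add_distrib,
      hM 1, hM 2] at h0
    have hq : ∑ y ∈ hfin.toFinset, inner ℂ y (q y) = 0 := by simpa using h0
    have hsum : ∑ y ∈ hfin.toFinset, inner ℂ y (p y) = 0 := by
      rw [hp]
      simp only [add_apply, inner_add_right, Finset.sum_add_distrib, hM 0, hq,
        add_zero]
    have hnorm : ∀ y, inner ℂ y (p y) = ((‖p y‖ ^ 2 : ℝ) : ℂ) := fun y => by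
      have : p y = p (p y) := by
        simpa using (congrArg (fun s : H →L[ℂ] H => s y) hpp).symm
      rw [this, ← inner_apply_eq_of_isSelfAdjoint hpsa, ← this, inner_self_eq_norm_sq_to_K]
      simp
    simp only [hnorm] at hsum
    rw [← Complex.ofReal_sum, Complex.ofReal_eq_zero,
      Finset.sum_eq_zero_iff_of_nonneg fun _ _ => by positivity] at hsum
    simpa using hsum z (by simpa using self_mem_orbit t z)
  · right
    have hsa' : IsSelfAdjoint (1 - p) := (IsSelfAdjoint.one _).sub hpsa
    -- Applying 1 - p twice makes the inner product with z equal to ‖(1 - p)z‖².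
    have h := inner_eq_zero_of_infinite_orbit hsa h1 h2 hO hz hfin (u := (1 - p) ((1 - p) z))
      fun i => by
        simpa only [mul_apply_eq_comp] using
          congrArg (fun s : H →L[ℂ] H => s ((1 - p) z)) (hfix i)
    rw [← inner_apply_eq_of_isSelfAdjoint hsa', inner_self_eq_zero] at h
    rw [sub_apply, one_apply_eq_self, sub_eq_zero] at h
    exact h.symm

end Dichotomy

/-! ### The GNS representation and its orthonormal set permuted by V. -/

section Representation

open scoped ComplexOrder

universe u

variable {A : Type u} [CStarAlgebra A] {S : Fin 2 → A}

/-- The limit of the compressions by the probes is a vector state. -/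
lemma exists_representation (hS : IsCuntzAlgebra S) :
    ∃ (H : Type u) (_ : NormedAddCommGroup H) (_ : InnerProductSpace ℂ H) (_ : CompleteSpace H)
      (π : A →⋆ₐ[ℂ] (H →L[ℂ] H)) (ξ : H), ∀ a c, HasValue S a c → inner ℂ ξ (π a ξ) = c := by
  let _ := CStarAlgebra.spectralOrder A
  let _ := CStarAlgebra.spectralOrderedRing A
  choose ω hω using exists_hasValue hS
  let f : A →ₚ[ℂ] ℂ := PositiveLinearMap.mk₀
    { toFun := ω
      map_add' := fun a b => (hω (a + b)).unique hS ((hω a).add (hω b))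
      map_smul' := fun k a => (hω (k • a)).unique hS ((hω a).smul k) }
    fun a ha => (hω a).nonneg hS ha
  refine ⟨f.GNS, inferInstance, inferInstance, inferInstance, f.gnsStarAlgHom,
    (f.toPreGNS 1 : f.GNS), fun a c hc => ?_⟩
  have : f a = c := (hω a).unique hS hc
  rw [← this]
  simp [PositiveLinearMap.preGNS_inner_def]

variable {H : Type*} [NormedAddCommGroup H] [InnerProductSpace ℂ H] [CompleteSpace H]
  {π : A →⋆ₐ[ℂ] (H →L[ℂ] H)} {ξ : H}

/-- The unit vectors among the `S_μ S_ν⋆ ξ`. -/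
def points (S : Fin 2 → A) (π : A →⋆ₐ[ℂ] (H →L[ℂ] H)) (ξ : H) : Set H :=
  {y | ‖y‖ = 1 ∧ ∃ m ∈ monomials S, y = π m ξ}

lemma inner_map_apply (a b : A) (ξ : H) :
    inner ℂ (π a ξ) (π b ξ) = inner ℂ ξ (π (star a * b) ξ) := by
  rw [map_mul, map_star, mul_apply_eq_comp, ContinuousLinearMap.star_eq_adjoint,
    ContinuousLinearMap.adjoint_inner_right]

variable (hS : IsCuntzAlgebra S) (hξ : ∀ a c, HasValue S a c → inner ℂ ξ (π a ξ) = c)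

include hS hξ

lemma inner_monomial {m m' : A} (hm : m ∈ monomials S) (hm' : m' ∈ monomials S) :
    inner ℂ (π m ξ) (π m' ξ) = 0 ∨ inner ℂ (π m ξ) (π m' ξ) = 1 := by
  obtain ⟨c, hc, h⟩ :=
    exists_hasValue_monomial hS (mul_mem_monomials hS (star_mem_monomials hm) hm')
  rw [inner_map_apply, hξ _ _ h]
  exact hc

lemma inner_points_of_ne {y y' : H} (hy : y ∈ points S π ξ) (hy' : y' ∈ points S π ξ)
    (h : y ≠ y') : inner ℂ y y' = 0 := by
  obtain ⟨h1, m, hm, rfl⟩ := hy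
  obtain ⟨h2, m', hm', rfl⟩ := hy'
  refine (inner_monomial hS hξ hm hm').resolve_right fun h3 => h ?_
  exact (inner_eq_one_iff_of_norm_eq_one h1 h2).1 h3

/-- The image of y is a unit vector and a sum of monomial vectors with pairwise inner products 0 or
1. The Gram matrix has nonnegative entries of total 1, so exactly one summand is nonzero. Nothing
beyond unitarity is needed of the index set `J`. -/
lemma map_thompsonV_mem_points {w : A} (hw : w ∈ thompsonV S) {y : H} (hy : y ∈ points S π ξ) :
    π w y ∈ points S π ξ := by
  obtain ⟨⟨J, hJ⟩, hu⟩ := hw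
  obtain ⟨h1, m, hm, rfl⟩ := hy
  set g : List (Fin 2) × List (Fin 2) → A := fun p => word S p.1 * star (word S p.2) * m with hg
  have hgm : ∀ p, g p ∈ monomials S := fun p =>
    mul_mem_monomials hS (word_mul_star_word_mem _ _) hm
  have hsum : π w (π m ξ) = ∑ p ∈ J, π (g p) ξ := by
    rw [hJ, ← mul_apply_eq_comp, ← map_mul, Finset.sum_mul, map_sum,
      sum_apply]
  have hnorm : ‖π w (π m ξ)‖ = 1 := by
    have : inner ℂ (π w (π m ξ)) (π w (π m ξ)) = inner ℂ (π m ξ) (π m ξ) := by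
      rw [inner_map_apply, Unitary.star_mul_self_of_mem hu]; simp
    refine norm_eq_one_of_inner_self (this.trans ?_)
    rw [inner_self_eq_norm_sq_to_K, h1]
    simp
  have hnn : ∀ p q, (0 : ℝ) ≤ (inner ℂ (π (g p) ξ) (π (g q) ξ)).re := fun p q => by
    obtain h | h := inner_monomial hS hξ (hgm p) (hgm q) <;> simp [h]
  have hdouble : ∑ p ∈ J, ∑ q ∈ J, (inner ℂ (π (g p) ξ) (π (g q) ξ)).re = 1 := by
    have : inner ℂ (π w (π m ξ)) (π w (π m ξ)) = 1 := by
      rw [inner_self_eq_norm_sq_to_K, hnorm]; simp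
    rw [hsum, sum_inner] at this
    simp only [inner_sum] at this
    simpa using congrArg Complex.re this
  obtain ⟨p, hp, hp0⟩ : ∃ p ∈ J, π (g p) ξ ≠ 0 := by
    by_contra! hcon
    rw [Finset.sum_eq_zero fun p hp => by simp [hcon p hp]] at hdouble
    exact zero_ne_one hdouble
  have hp1 : inner ℂ (π (g p) ξ) (π (g p) ξ) = 1 :=
    (inner_monomial hS hξ (hgm p) (hgm p)).resolve_left fun h => hp0 (inner_self_eq_zero.1 h)
  have hother : ∀ q ∈ J, q ≠ p → π (g q) ξ = 0 := fun q hq hqp => by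
    by_contra hq0
    have hq1 : inner ℂ (π (g q) ξ) (π (g q) ξ) = 1 :=
      (inner_monomial hS hξ (hgm q) (hgm q)).resolve_left fun h => hq0 (inner_self_eq_zero.1 h)
    have hrow : ∀ r ∈ J, inner ℂ (π (g r) ξ) (π (g r) ξ) = 1 →
        1 ≤ ∑ s ∈ J, (inner ℂ (π (g r) ξ) (π (g s) ξ)).re := fun r hr h => by
      refine le_trans (by rw [h, Complex.one_re]) (Finset.single_le_sum (fun s _ => hnn r s) hr)
    have h2 := Finset.add_le_sum (fun r _ => Finset.sum_nonneg fun s (_ : s ∈ J) => hnn r s)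
      hp hq hqp.symm
    have h3 := (add_le_add (hrow p hp hp1) (hrow q hq hq1)).trans (h2.trans_eq hdouble)
    norm_num at h3
  refine ⟨hnorm, g p, hgm p, ?_⟩
  rw [hsum, Finset.sum_eq_single p hother fun h => (h hp).elim]

lemma map_word_mem_points (μ : List (Fin 2)) : π (word S μ) ξ ∈ points S π ξ := by
  refine ⟨?_, _, word_mem_monomials μ, rfl⟩
  have h : inner ℂ (π (word S μ) ξ) (π (word S μ) ξ) = 1 := by
    rw [inner_map_apply, star_word_mul_word_self hS]
    exact hξ 1 1 (by simp [HasValue, star_probe_mul_probe hS])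
  exact norm_eq_one_of_inner_self h

/-- An operator diagonal on the points has vanishing off-diagonal coefficients. -/
lemma hasValue_zero_of_diagonal {e : A} (he : ∀ y ∈ points S π ξ, π e y = 0 ∨ π e y = y)
    {μ ν : List (Fin 2)} (hμν : μ ≠ ν) : HasValue S (star (word S μ) * e * word S ν) 0 := by
  obtain ⟨c, hc⟩ := exists_hasValue hS (star (word S μ) * e * word S ν)
  have h := hξ _ _ hc
  rw [mul_assoc, ← inner_map_apply, map_mul, mul_apply_eq_comp] at h
  obtain h0 | h0 := he _ (map_word_mem_points hS hξ ν)
  · rw [h0, inner_zero_right] at h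
    rwa [h]
  · rw [h0, inner_map_apply, hξ _ _ (hasValue_star_word_mul_word_of_ne hS hμν)] at h
    rwa [h]

end Representation

end Cuntz

namespace Cuntz

variable {A : Type*} [CStarAlgebra A]

/-! ### Averages that almost commute with monomials, and recovery from coefficients. -/

section Averages

variable {S : Fin 2 → A}

/-- `∑_{k < N} Φᵏ(v)`, where `Φ` is the canonical endomorphism. -/
def average (S : Fin 2 → A) (N : ℕ) (v : A) : A := ∑ k ∈ Finset.range N, (shift S)^[k] v

/-- The isometries Φᵏ(z n), k < N, have orthogonal ranges: for 0 < m ≤ n, moving S₀ᵐ⋆ past Φᵐ(z n)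
leaves (z (n - m))⋆ (z n) = 0. -/
lemma star_average_mul_average (hS : IsCuntzAlgebra S) {N n : ℕ} (hn : N ≤ n) :
    star (average S N (probe S n)) * average S N (probe S n) = N := by
  have hcomm : ∀ j m,
      star (S 0 ^ m) * (shift S)^[m] (probe S j) = probe S j * star (S 0 ^ m) := fun j m => by
    induction m with
    | zero => simp
    | succ m ih =>
      rw [Function.iterate_succ_apply', pow_succ', star_mul, mul_assoc, star_mul_shift hS,
        ← mul_assoc, ih, mul_assoc]
  have hpos : ∀ m, 0 < m → m ≤ n → star (probe S n) * (shift S)^[m] (probe S n) = 0 := by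
    intro m hm hmn
    have h1 : star (probe S n)
        = star (S 1) * star (S 0 ^ (n - m)) * star (S 0 ^ m) := by
      have h : S 0 ^ n = S 0 ^ m * S 0 ^ (n - m) := by rw [← pow_add, Nat.add_sub_cancel' hmn]
      rw [probe, h, star_mul, star_mul, mul_assoc]
    have h2 : star (S 1) * star (S 0 ^ (n - m)) * probe S n = 0 := by
      rw [← star_mul]
      have := star_probe_mul_probe hS (n - m) n
      rwa [if_neg (by omega)] at this
    rw [h1, mul_assoc, hcomm n m, ← mul_assoc, h2, zero_mul]
  have hlt : ∀ i j, i < j → j ≤ n →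
      star ((shift S)^[i] (probe S n)) * (shift S)^[j] (probe S n) = 0 := by
    intro i j hij hj
    obtain ⟨m, rfl⟩ := Nat.exists_eq_add_of_lt hij
    rw [add_assoc, Function.iterate_add_apply, ← shift_iterate_star_mul hS,
      hpos _ (by omega) (by omega), Function.iterate_fixed shift_zero]
  have hdiag : ∀ i, star ((shift S)^[i] (probe S n)) * (shift S)^[i] (probe S n) = 1 := by
    intro i
    rw [← shift_iterate_star_mul hS, star_probe_mul_probe hS, if_pos rfl,
      Function.iterate_fixed (shift_one hS)]
  rw [average, star_sum, Finset.sum_mul]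
  calc _ = ∑ i ∈ Finset.range N, (1 : A) := by
        refine Finset.sum_congr rfl fun i hi => ?_
        rw [Finset.mul_sum, Finset.sum_eq_single i, hdiag]
        · intro j hj hji
          simp only [Finset.mem_range] at hi hj
          obtain h | h := lt_or_gt_of_ne hji
          · have := hlt j i h (by omega)
            rw [← star_inj, star_mul, star_star, this, star_zero]
          · exact hlt i j h (by omega)
        · exact fun h => (h hi).elim
    _ = N := by simp

lemma norm_sq_average_le (hS : IsCuntzAlgebra S) {N n : ℕ} (hn : N ≤ n) :
    ‖average S N (probe S n)‖ * ‖average S N (probe S n)‖ ≤ N := by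
  rw [← CStarRing.norm_star_mul_self, star_average_mul_average hS hn]
  have : Nontrivial A := ⟨1, 0, hS.one_ne_zero⟩
  rw [← map_natCast (algebraMap ℂ A), norm_algebraMap', Complex.norm_natCast]

/-- The sum telescopes: moving S_i⋆ across shifts the index by one, so only the two end terms
survive, each of norm at most 1. -/
lemma norm_commutator_average_le (hS : IsCuntzAlgebra S) (N n : ℕ) (i : Fin 2) :
    ‖star (S i) * average S N (probe S n) - average S N (probe S n) * star (S i)‖ ≤ 2 := by
  have hSi : ‖star (S i)‖ ≤ 1 := by
    rw [norm_star]; exact norm_le_one_of_star_mul_self (hS.isometry i)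
  have hz : ∀ k, ‖(shift S)^[k] (probe S n)‖ ≤ 1 := fun k => norm_le_one_of_star_mul_self <| by
    rw [← shift_iterate_star_mul hS, star_probe_mul_probe hS, if_pos rfl,
      Function.iterate_fixed (shift_one hS)]
  cases N with
  | zero => simp [average]
  | succ N =>
    have h1 : star (S i) * average S (N + 1) (probe S n)
        = average S N (probe S n) * star (S i) + star (S i) * probe S n := by
      rw [average, Finset.sum_range_succ', mul_add, Finset.mul_sum, average, Finset.sum_mul]
      simp only [Function.iterate_succ_apply', star_mul_shift hS, Function.iterate_zero, id]
    have h2 : average S (N + 1) (probe S n) * star (S i)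
        = average S N (probe S n) * star (S i) + (shift S)^[N] (probe S n) * star (S i) := by
      rw [average, Finset.sum_range_succ, add_mul, ← average]
    rw [h1, h2, add_sub_add_left_eq_sub]
    calc _ ≤ ‖star (S i)‖ * ‖probe S n‖ + ‖(shift S)^[N] (probe S n)‖ * ‖star (S i)‖ :=
          (norm_sub_le _ _).trans (add_le_add (norm_mul_le _ _) (norm_mul_le _ _))
      _ ≤ 1 * 1 + 1 * 1 := by
          have := norm_probe_le hS n
          have := hz N
          gcongr
      _ = 2 := by norm_num

lemma norm_commutator_word_average_le (hS : IsCuntzAlgebra S) (N n : ℕ) (μ : List (Fin 2)) :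
    ‖star (word S μ) * average S N (probe S n) - average S N (probe S n) * star (word S μ)‖
      ≤ 2 * μ.length := by
  induction μ with
  | nil => simp
  | cons i μ ih =>
    set Y := average S N (probe S n)
    have hμ : ‖star (word S μ)‖ ≤ 1 := by
      rw [norm_star]; exact norm_le_one_of_star_mul_self (star_word_mul_word_self hS μ)
    have hSi : ‖star (S i)‖ ≤ 1 := by
      rw [norm_star]; exact norm_le_one_of_star_mul_self (hS.isometry i)
    have h : star (word S (i :: μ)) * Y - Y * star (word S (i :: μ))
        = star (word S μ) * (star (S i) * Y - Y * star (S i))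
          + (star (word S μ) * Y - Y * star (word S μ)) * star (S i) := by
      rw [word_cons, star_mul]; noncomm_ring
    rw [h]
    calc _ ≤ ‖star (word S μ)‖ * ‖star (S i) * Y - Y * star (S i)‖
          + ‖star (word S μ) * Y - Y * star (word S μ)‖ * ‖star (S i)‖ :=
          (norm_add_le _ _).trans (add_le_add (norm_mul_le _ _) (norm_mul_le _ _))
      _ ≤ 1 * 2 + 2 * μ.length * 1 := by
          have := norm_commutator_average_le hS N n i
          gcongr
      _ = 2 * (i :: μ).length := by push_cast [List.length_cons]; ring

/-- Compression by averages is asymptotically trivial on the span of the monomials. -/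
lemma exists_norm_compress_average_sub_le (hS : IsCuntzAlgebra S) {p : A}
    (hp : p ∈ Submodule.span ℂ (monomials S)) :
    ∃ C : ℝ, ∀ N n : ℕ, N ≤ n →
      ‖star (average S N (probe S n)) * p * average S N (probe S n) - (N : ℂ) • p‖
        ≤ C * √N := by
  induction hp using Submodule.span_induction with
  | zero => exact ⟨0, by simp⟩
  | add x y _ _ hx hy =>
    obtain ⟨C, hC⟩ := hx
    obtain ⟨D, hD⟩ := hy
    refine ⟨C + D, fun N n h => ?_⟩
    rw [mul_add, add_mul, smul_add, add_sub_add_comm, add_mul]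
    exact (norm_add_le _ _).trans (add_le_add (hC N n h) (hD N n h))
  | smul k x _ hx =>
    obtain ⟨C, hC⟩ := hx
    refine ⟨‖k‖ * C, fun N n h => ?_⟩
    rw [mul_smul_comm, smul_mul_assoc, smul_comm, ← smul_sub, norm_smul]
    exact (mul_le_mul_of_nonneg_left (hC N n h) (norm_nonneg k)).trans_eq (mul_assoc _ _ _).symm
  | mem x hx =>
    obtain rfl | ⟨μ, ν, rfl⟩ := hx
    · exact ⟨0, by simp⟩
    refine ⟨2 * μ.length + 2 * ν.length, fun N n h => ?_⟩
    have hYY := star_average_mul_average hS h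
    have hYn := norm_sq_average_le hS h
    have hμY := norm_commutator_word_average_le hS N n μ
    have hνY := norm_commutator_word_average_le hS N n ν
    set Y := average S N (probe S n)
    have hY : ‖Y‖ ≤ √N := Real.le_sqrt_of_sq_le (by rwa [sq])
    have hμ : ‖word S μ‖ ≤ 1 := norm_le_one_of_star_mul_self (star_word_mul_word_self hS μ)
    have hN : (N : ℂ) • (word S μ * star (word S ν))
        = word S μ * (star Y * Y) * star (word S ν) := by
      rw [hYY, ← map_natCast (algebraMap ℂ A) N, ← Algebra.commutes, mul_assoc, Algebra.smul_def]
    -- Each term has one commutator, bounded independently of N, and one factor of `Y`, of norm at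
    -- most √N; hence the order √N.
    have key : star Y * (word S μ * star (word S ν)) * Y - (N : ℂ) • (word S μ * star (word S ν))
        = star (star (word S μ) * Y - Y * star (word S μ)) * (star (word S ν) * Y)
          + word S μ * star Y * (star (word S ν) * Y - Y * star (word S ν)) := by
      rw [hN, star_sub, star_mul, star_mul, star_star]; noncomm_ring
    have hν : ‖star (word S ν)‖ ≤ 1 := by
      rw [norm_star]; exact norm_le_one_of_star_mul_self (star_word_mul_word_self hS ν)
    rw [key]
    calc _ ≤ ‖star (star (word S μ) * Y - Y * star (word S μ))‖ * (‖star (word S ν)‖ * ‖Y‖)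
          + ‖word S μ‖ * ‖star Y‖ * ‖star (word S ν) * Y - Y * star (word S ν)‖ := by
          refine (norm_add_le _ _).trans (add_le_add ?_ ?_)
          · exact (norm_mul_le _ _).trans (by gcongr; exact norm_mul_le _ _)
          · exact norm_mul₃_le
      _ ≤ 2 * μ.length * (1 * √N) + 1 * √N * (2 * ν.length) := by
          rw [norm_star, norm_star Y]
          gcongr
      _ = (2 * μ.length + 2 * ν.length) * √N := by ring

/-- Every element is approximated by its compressions by averages. -/
lemma exists_norm_sub_compress_average_lt (hS : IsCuntzAlgebra S) (a : A) {ε : ℝ} (hε : 0 < ε) :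
    ∃ N : ℕ, ∀ n, N ≤ n →
      ‖a - (N : ℂ)⁻¹ • (star (average S N (probe S n)) * a * average S N (probe S n))‖ < ε := by
  obtain ⟨p, hp, hap⟩ := Metric.mem_closure_iff.1 (mem_closure_span_monomials hS a) (ε / 3)
    (by positivity)
  rw [dist_eq_norm] at hap
  obtain ⟨C, hC⟩ := exists_norm_compress_average_sub_le hS hp
  have hlim : Tendsto (fun N : ℕ => C * (√(N : ℝ))⁻¹) atTop (𝓝 (C * 0)) :=
    ((Real.tendsto_sqrt_atTop.comp tendsto_natCast_atTop_atTop).inv_tendsto_atTop).const_mul C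
  rw [mul_zero] at hlim
  obtain ⟨N, hN, hN1⟩ := ((hlim.eventually (gt_mem_nhds (show 0 < ε / 3 by positivity))).and
    (eventually_ge_atTop 1)).exists
  refine ⟨N, fun n hn => ?_⟩
  have hNr : (0 : ℝ) < N := by exact_mod_cast hN1
  have hNc : (N : ℂ) ≠ 0 := by exact_mod_cast hNr.ne'
  have hYn := norm_sq_average_le hS hn
  have hp' := hC N n hn
  set Y := average S N (probe S n)
  have hdecomp : a - (N : ℂ)⁻¹ • (star Y * a * Y)
      = (a - p) - (N : ℂ)⁻¹ • (star Y * (a - p) * Y)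
        - (N : ℂ)⁻¹ • (star Y * p * Y - (N : ℂ) • p) := by
    rw [smul_sub (N : ℂ)⁻¹ _ ((N : ℂ) • p), smul_smul, inv_mul_cancel₀ hNc, one_smul, mul_sub,
      sub_mul, smul_sub]
    abel
  have hb : ‖(N : ℂ)⁻¹ • (star Y * (a - p) * Y)‖ ≤ ‖a - p‖ := by
    rw [norm_smul, norm_inv, Complex.norm_natCast, inv_mul_le_iff₀ hNr]
    calc _ ≤ ‖star Y‖ * ‖a - p‖ * ‖Y‖ := norm_mul₃_le
      _ = (‖Y‖ * ‖Y‖) * ‖a - p‖ := by rw [norm_star]; ring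
      _ ≤ N * ‖a - p‖ := by gcongr
  have hc : ‖(N : ℂ)⁻¹ • (star Y * p * Y - (N : ℂ) • p)‖ < ε / 3 := by
    rw [norm_smul, norm_inv, Complex.norm_natCast]
    refine lt_of_le_of_lt ?_ hN
    rw [inv_mul_le_iff₀ hNr]
    refine hp'.trans_eq ?_
    have hs : √(N : ℝ) ≠ 0 := (Real.sqrt_pos.2 hNr).ne'
    field_simp
    rw [Real.sq_sqrt hNr.le]
  rw [hdecomp]
  have h1 := norm_sub_le ((a - p) - (N : ℂ)⁻¹ • (star Y * (a - p) * Y))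
    ((N : ℂ)⁻¹ • (star Y * p * Y - (N : ℂ) • p))
  have h2 := norm_sub_le (a - p) ((N : ℂ)⁻¹ • (star Y * (a - p) * Y))
  linarith

lemma proj_mem_diagonal (μ : List (Fin 2)) : proj S μ ∈ diagonal S :=
  StarSubalgebra.le_topologicalClosure _ (StarAlgebra.subset_adjoin _ _ ⟨μ, rfl⟩)

lemma isClosed_diagonal : IsClosed (diagonal S : Set A) :=
  StarSubalgebra.isClosed_topologicalClosure _

/-- An element whose off-diagonal coefficients vanish lies in the diagonal. -/
lemma mem_diagonal_of_hasValue_zero (hS : IsCuntzAlgebra S) {e : A}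
    (he : ∀ μ ν, μ ≠ ν → HasValue S (star (word S μ) * e * word S ν) 0) : e ∈ diagonal S := by
  rw [← SetLike.mem_coe, ← isClosed_diagonal.closure_eq, Metric.mem_closure_iff]
  intro ε hε
  obtain ⟨N, hN⟩ := exists_norm_sub_compress_average_lt hS e (half_pos hε)
  choose ω hω using fun a => exists_hasValue hS a
  -- Expanding Φⁱ and Φʲ over words puts the compression by `probe S n` around S_μ⋆ e S_ν; its limit
  -- is scalar, and only μ = ν contributes, giving multiples of P_μ.
  have hlim : ∀ i j, ∃ d ∈ diagonal S, Tendsto (fun n =>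
      star ((shift S)^[i] (probe S n)) * e * (shift S)^[j] (probe S n)) atTop (𝓝 d) := by
    intro i j
    refine ⟨∑ μ ∈ levelWords 2 i, ∑ ν ∈ levelWords 2 j, word S μ * algebraMap ℂ A
      (ω (star (word S μ) * e * word S ν)) * star (word S ν), ?_, ?_⟩
    · refine sum_mem fun μ _ => sum_mem fun ν _ => ?_
      by_cases h : μ = ν
      · subst h
        rw [← Algebra.commutes, mul_assoc]
        exact mul_mem (algebraMap_mem _ _) (proj_mem_diagonal μ)
      · rw [(hω _).unique hS (he μ ν h)]
        simp
    · have : ∀ n, star ((shift S)^[i] (probe S n)) * e * (shift S)^[j] (probe S n)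
          = ∑ μ ∈ levelWords 2 i, ∑ ν ∈ levelWords 2 j, word S μ *
            (star (probe S n) * (star (word S μ) * e * word S ν) * probe S n)
              * star (word S ν) := fun n => by
        rw [shift_iterate, shift_iterate, star_sum, Finset.sum_mul, Finset.sum_mul]
        refine Finset.sum_congr rfl fun μ _ => ?_
        rw [Finset.mul_sum]
        exact Finset.sum_congr rfl fun ν _ => by simp [mul_assoc]
      simp only [this]
      exact tendsto_finsetSum _ fun μ _ => tendsto_finsetSum _ fun ν _ =>
        ((hω _).const_mul _).mul_const _
  choose d hd hd' using hlim
  have hlimY : Tendsto (fun n => (N : ℂ)⁻¹ •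
      (star (average S N (probe S n)) * e * average S N (probe S n))) atTop
      (𝓝 ((N : ℂ)⁻¹ • ∑ i ∈ Finset.range N, ∑ j ∈ Finset.range N, d i j)) := by
    refine Tendsto.const_smul ?_ _
    have : ∀ n, star (average S N (probe S n)) * e * average S N (probe S n)
        = ∑ i ∈ Finset.range N, ∑ j ∈ Finset.range N,
          star ((shift S)^[i] (probe S n)) * e * (shift S)^[j] (probe S n) := fun n => by
      simp only [average, star_sum, Finset.sum_mul, Finset.mul_sum]
      exact Finset.sum_comm
    simp only [this]
    exact tendsto_finsetSum _ fun i _ => tendsto_finsetSum _ fun j _ => hd' i j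
  refine ⟨_, SMulMemClass.smul_mem (N : ℂ)⁻¹
    (sum_mem fun i (_ : i ∈ Finset.range N) => sum_mem fun j (_ : j ∈ Finset.range N) => hd i j), ?_⟩
  rw [dist_eq_norm]
  refine lt_of_le_of_lt (le_of_tendsto (hlimY.const_sub e).norm ?_) (half_lt_self hε)
  filter_upwards [eventually_ge_atTop N] with n hn using (hN n hn).le

end Averages

/-! ### Transpositions of cones as elements of V. -/

section Transposition

variable {n : ℕ} {S : Fin n → A}

/-- The unitary exchanging `S_μ` and `S_ν`, for incomparable `μ` and `ν`. -/
def transposition (S : Fin n → A) (μ ν : List (Fin n)) : A :=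
  1 - (word S μ - word S ν) * star (word S μ - word S ν)

lemma isSelfAdjoint_transposition (μ ν : List (Fin n)) :
    IsSelfAdjoint (transposition S μ ν) :=
  (IsSelfAdjoint.one A).sub (IsSelfAdjoint.mul_star_self _)

lemma star_word_mul_word_comm {μ ν : List (Fin n)} (h : star (word S μ) * word S ν = 0) :
    star (word S ν) * word S μ = 0 := by
  rw [← star_inj, star_mul, star_star, h, star_zero]

lemma transposition_mul_self (hS : IsCuntzAlgebra S) {μ ν : List (Fin n)}
    (h : star (word S μ) * word S ν = 0) :
    transposition S μ ν * transposition S μ ν = 1 := by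
  have hk : star (word S μ - word S ν) * (word S μ - word S ν) = 2 := by
    rw [star_sub, sub_mul, mul_sub, mul_sub, star_word_mul_word_self hS,
      star_word_mul_word_self hS, h, star_word_mul_word_comm h]
    norm_num
  set k := word S μ - word S ν with hkdef
  have : k * star k * (k * star k) = 2 * (k * star k) := by
    rw [mul_assoc, ← mul_assoc (star k), hk, two_mul, two_mul, mul_add]
  calc (1 - k * star k) * (1 - k * star k)
      = 1 - 2 * (k * star k) + k * star k * (k * star k) := by noncomm_ring
    _ = 1 := by rw [this, sub_add_cancel]

lemma transposition_mul_word (hS : IsCuntzAlgebra S) {μ ν : List (Fin n)}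
    (h : star (word S μ) * word S ν = 0) :
    transposition S μ ν * word S μ = word S ν := by
  have hk : star (word S μ - word S ν) * word S μ = 1 := by
    rw [star_sub, sub_mul, star_word_mul_word_self hS, star_word_mul_word_comm h, sub_zero]
  rw [transposition, sub_mul, mul_assoc, hk]
  noncomm_ring

lemma transposition_conj_proj (hS : IsCuntzAlgebra S) {μ ν : List (Fin n)}
    (h : star (word S μ) * word S ν = 0) :
    transposition S μ ν * proj S μ * transposition S μ ν = proj S ν := by
  have h1 := transposition_mul_word hS h
  have h2 : star (word S μ) * transposition S μ ν = star (word S ν) := by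
    rw [← h1, star_mul, (isSelfAdjoint_transposition μ ν).star_eq]
  rw [proj, ← mul_assoc, h1, mul_assoc, h2, proj]

lemma transposition_mul_one_sub_proj (hS : IsCuntzAlgebra S) (μ σ τ : List (Fin n)) :
    transposition S (μ ++ σ) (μ ++ τ) * (1 - proj S μ) = 1 - proj S μ := by
  have : star (word S μ) * (1 - proj S μ) = 0 := by
    rw [proj, mul_sub, ← mul_assoc, star_word_mul_word_self hS, mul_one, one_mul, sub_self]
  rw [transposition, sub_mul, one_mul, word_append, word_append, ← mul_sub, star_mul]
  simp only [mul_assoc, this, mul_zero, sub_zero]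

/-- `K` lists the cones on which the transposition is the identity; together with the swapped pair
they give an expression as a sum of monomials. -/
lemma transposition_mem_thompsonV (hS : IsCuntzAlgebra S) {μ ν : List (Fin n)}
    (h : star (word S μ) * word S ν = 0) {K : Finset (List (Fin n))}
    (hK : ∑ κ ∈ K, proj S κ = 1 - proj S μ - proj S ν) : transposition S μ ν ∈ thompsonV S := by
  have hne : μ ≠ ν := by
    rintro rfl
    exact hS.one_ne_zero (by rw [← star_word_mul_word_self hS μ, h])
  refine ⟨⟨K.image (fun κ => (κ, κ)) ∪ {(μ, ν), (ν, μ)}, ?_⟩, ?_⟩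
  · rw [Finset.sum_union, Finset.sum_image, Finset.sum_pair]
    · change _ = ∑ κ ∈ K, proj S κ + _
      rw [hK, transposition]
      simp only [proj]
      rw [star_sub]
      noncomm_ring
    · simp [hne]
    · simp
    · rw [Finset.disjoint_left]
      rintro p hp hp'
      simp only [Finset.mem_image] at hp
      obtain ⟨κ, -, rfl⟩ := hp
      simp only [Finset.mem_insert, Finset.mem_singleton, Prod.mk.injEq] at hp'
      obtain ⟨h1, h2⟩ | ⟨h1, h2⟩ := hp'
      · exact hne (h1.symm.trans h2)
      · exact hne (h2.symm.trans h1)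
  · rw [SetLike.mem_coe, Unitary.mem_iff, (isSelfAdjoint_transposition μ ν).star_eq]
    exact ⟨transposition_mul_self hS h, transposition_mul_self hS h⟩

lemma star_word_append_mul_word_append_eq_zero (hS : IsCuntzAlgebra S) (μ σ τ : List (Fin n))
    {i j : Fin n} (hij : i ≠ j) :
    star (word S (μ ++ i :: σ)) * word S (μ ++ j :: τ) = 0 := by
  rw [star_word_append_mul_word_append hS, word_cons, word_cons, star_mul, mul_assoc,
    ← mul_assoc (star (S i)), star_mul_of_ne hS hij, zero_mul, mul_zero]

lemma sum_erase_levelWords_proj (hS : IsCuntzAlgebra S) (μ : List (Fin n)) :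
    ∑ κ ∈ (levelWords n μ.length).erase μ, proj S κ = 1 - proj S μ := by
  rw [eq_sub_iff_add_eq, Finset.sum_erase_add _ _ (mem_levelWords.2 rfl),
    sum_levelWords_proj hS]

end Transposition

/-! ### Images of the generating projections, and the theorem. -/

section Main

variable {S : Fin 2 → A}

lemma proj_eq_add (hS : IsCuntzAlgebra S) (μ : List (Fin 2)) :
    proj S μ = proj S (μ ++ [0]) + proj S (μ ++ [1]) := by
  rw [proj_append, proj_append, ← add_mul, ← mul_add]
  have : proj S [0] + proj S [1] = 1 := by
    simpa [proj] using hS.sum_range_proj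
  rw [this, mul_one, proj]

/-- Words that together with `0` generate, by transpositions, enough mixing below a cone. -/
def partner : Fin 3 → List (Fin 2) := ![[1], [1, 0], [1, 1]]

lemma transposition_partner_mem (hS : IsCuntzAlgebra S) (μ : List (Fin 2)) (i : Fin 3) :
    transposition S (μ ++ [0]) (μ ++ partner i) ∈ thompsonV S := by
  have h := sum_erase_levelWords_proj hS μ
  have h1 := proj_eq_add hS μ
  have h2 := proj_eq_add hS (μ ++ [1])
  simp only [List.append_assoc, List.cons_append, List.nil_append] at h2
  -- The untouched cones are the other words of the length of μ, plus, when only half of μ1 is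
  -- swapped, the remaining half.
  have hins : ∀ τ : List (Fin 2), τ ≠ [] →
      ∑ κ ∈ insert (μ ++ τ) ((levelWords 2 μ.length).erase μ), proj S κ
        = proj S (μ ++ τ) + (1 - proj S μ) := fun τ hτ => by
    rw [Finset.sum_insert (by simp [mem_levelWords, hτ]), h]
  fin_cases i
  · refine transposition_mem_thompsonV hS
      (star_word_append_mul_word_append_eq_zero hS μ [] [] zero_ne_one)
      (K := (levelWords 2 μ.length).erase μ) ?_
    rw [h, h1]
    simp only [partner, Fin.zero_eta, Matrix.cons_val_zero]
    abel
  · refine transposition_mem_thompsonV hS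
      (star_word_append_mul_word_append_eq_zero hS μ [] [0] zero_ne_one)
      (K := insert (μ ++ [1, 1]) ((levelWords 2 μ.length).erase μ)) ?_
    rw [hins _ (by simp), h1, h2]
    abel
  · refine transposition_mem_thompsonV hS
      (star_word_append_mul_word_append_eq_zero hS μ [] [1] zero_ne_one)
      (K := insert (μ ++ [1, 0]) ((levelWords 2 μ.length).erase μ)) ?_
    rw [hins _ (by simp), h1, h2]
    abel

lemma star_word_mul_word_partner (hS : IsCuntzAlgebra S) (μ : List (Fin 2)) (i : Fin 3) :
    star (word S (μ ++ [0])) * word S (μ ++ partner i) = 0 := by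
  fin_cases i <;> exact star_word_append_mul_word_append_eq_zero hS μ [] _ zero_ne_one

lemma map_proj_mem_diagonal (hS : IsCuntzAlgebra S) (α : A →⋆ₐ[ℂ] A)
    (hα : α '' thompsonV S ⊆ thompsonV S) (μ : List (Fin 2)) : α (proj S μ) ∈ diagonal S := by
  obtain ⟨H, _, _, _, π, ξ, hξ⟩ := exists_representation hS
  refine mem_diagonal_of_hasValue_zero hS fun σ τ hστ =>
    hasValue_zero_of_diagonal hS hξ (fun y hy => ?_) hστ
  set ρ : A →⋆ₐ[ℂ] (H →L[ℂ] H) := π.comp α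
  -- The halves of P_μ are P_{μ0} and P_{μ1}, the latter split again into P_{μ10} and P_{μ11}; the
  -- hypothesis on α enters only in that the images of the transpositions preserve the points.
  refine apply_eq_zero_or_self (O := points S π ξ) (fun y hy => hy.1)
    (fun y hy y' hy' => inner_points_of_ne hS hξ hy hy')
    (t := fun i => ρ (transposition S (μ ++ [0]) (μ ++ partner i)))
    (q := ρ (proj S (μ ++ [0]))) (r := fun i => ρ (proj S (μ ++ partner i)))
    (fun i => (isSelfAdjoint_transposition _ _).map ρ) (fun i => ?_) (fun i y hy => ?_)
    ((IsSelfAdjoint.mul_star_self (word S μ)).map ρ) ?_ ?_ ?_ (fun i => ?_) (fun i => ?_) hy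
  · rw [← map_mul, transposition_mul_self hS (star_word_mul_word_partner hS μ i), map_one]
  · exact map_thompsonV_mem_points hS hξ (hα ⟨_, transposition_partner_mem hS μ i, rfl⟩) hy
  · change ρ (proj S μ) * ρ (proj S μ) = ρ (proj S μ)
    rw [← map_mul, proj, mul_assoc, ← mul_assoc (star _), star_word_mul_word_self hS, one_mul]
  · change ρ (proj S μ) = _
    rw [proj_eq_add hS μ, map_add]
    rfl
  · change ρ (proj S (μ ++ [1])) = _
    rw [proj_eq_add hS, map_add]
    simp [partner]
  · rw [← map_mul, ← map_mul, transposition_conj_proj hS (star_word_mul_word_partner hS μ i)]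
  · change _ * (1 - ρ (proj S μ)) = 1 - ρ (proj S μ)
    rw [← map_one ρ, ← map_sub, ← map_mul, transposition_mul_one_sub_proj hS]

end Main

end Cuntz

open scoped CStarAlgebra in
lemma Cuntz.continuous_starAlgHom {A : Type*} [CStarAlgebra A] (α : A →⋆ₐ[ℂ] A) : Continuous α :=
  map_continuous α

theorem lemma3p9 {A : Type*} [CStarAlgebra A] (S : Fin 2 → A) (hS : IsCuntzAlgebra S)
    (α : A →⋆ₐ[ℂ] A) (hα : α '' Cuntz.thompsonV S ⊆ Cuntz.thompsonV S) :
    α '' (Cuntz.diagonal S : Set A) ⊆ (Cuntz.diagonal S : Set A) := by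
  have hle : StarAlgebra.adjoin ℂ (Set.range (Cuntz.proj S)) ≤ (Cuntz.diagonal S).comap α := by
    refine StarAlgebra.adjoin_le ?_
    rintro _ ⟨μ, rfl⟩
    exact Cuntz.map_proj_mem_diagonal hS α hα μ
  have hclosed : IsClosed ((Cuntz.diagonal S).comap α : Set A) :=
    Cuntz.isClosed_diagonal.preimage (Cuntz.continuous_starAlgHom α)
  rintro _ ⟨a, ha, rfl⟩
  exact StarSubalgebra.topologicalClosure_minimal hle hclosed ha
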